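/- \textbf{Lemma.} Let $1\le k\le n$, $t>0$, $a_0>0$, and let $u_1\ge u_2\ge\dots\ge u_n$ be real numbers (intrinsic utilities). For a price vector $p\in\mathbb{R}^k$ put $a_i(p_i)=\exp(u_i-p_i)$ and \[R^{(k)}(p)=\frac{\sum_{i=1}^k p_i\,\exp(u_i-p_i)}{\sum_{i=1}^k \exp(u_i-p_i)+a_0},\] and consider the problem (JAPTLM-$k$) of maximizing $R^{(k)}(p)$ over all $p\in\mathbb{R}^k$ subject to $\exp(u_i-p_i)-(1+t)\exp(u_j-p_j)\le 0$ for all $1\le i<j\le k$. Let $W:[0,\infty)\to[0,\infty)$ be the Lambert function, the unique function with $W(x)e^{W(x)}=x$ for all $x\ge0$. The problem (JAPTLM-$k$) has exactly one optimal solution $p$. Write $R=R^{(k)}(p)$ for the optimal revenue. (a) If $\exp(u_1-u_k)\le 1+t$, then $p$ also maximizes $R^{(k)}$ over all of $\mathbb{R}^k$ without constraints, and \[R=W\Big(\frac{\sum_{i=1}^k\exp(u_i-1)}{a_0}\Big),\qquad p_i=1+R\quad\text{for all } 1\le i\le k.\] (b) If $\exp(u_1-u_k)>1+t$, then $\dfrac{a_1(p_1)}{a_k(p_k)}=1+t$,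 and there are positive integers $k_1,k_2$ with $k_1+k_2\le k$ such that, with $I_1=\{1,\dots,k_1\}$, $I_2=\{k-k_2+1,\dots,k\}$, $\bar I_k=\{1,\dots,k\}\setminus(I_1\cup I_2)$ and \[C=\frac{(1+t)\sum_{i\in I_1}u_i+\sum_{i\in I_2}u_i+k_2\ln(1+t)}{k_1(1+t)+k_2},\] one has \[R=W\left(\frac{\left(k_1+\frac{k_2}{1+t}\right)\exp(C-1)+\sum_{i\in\bar I_k}\exp(u_i-1)}{a_0}\right)\] and \[p_i=\begin{cases}1+R+u_i-C & \text{if } i\in I_1,\\ 1+R+u_i-C+\ln(1+t) & \text{if } i\in I_2,\\ 1+R & \text{if } i\in\bar I_k.\end{cases}\] -/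

import Mathlib

open Real

noncomputable section

/-- For every `x ≥ 0` the equation `w * exp w = x` has exactly one solution `w ≥ 0`. -/
theorem existsUnique_lambertW (x : ℝ) (hx : 0 ≤ x) :
    ∃! w : ℝ, 0 ≤ w ∧ w * Real.exp w = x := by
  have hcont : ContinuousOn (fun w : ℝ => w * Real.exp w) (Set.Icc 0 x) := by fun_prop
  have hmem : x ∈ Set.Icc ((fun w : ℝ => w * Real.exp w) 0)
      ((fun w : ℝ => w * Real.exp w) x) := by
    refine ⟨by simpa using hx, ?_⟩
    have h1 : 1 ≤ Real.exp x := Real.one_le_exp hx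
    have h2 : x * 1 ≤ x * Real.exp x := mul_le_mul_of_nonneg_left h1 hx
    simpa using h2
  obtain ⟨w, hw, hwx⟩ := intermediate_value_Icc hx hcont hmem
  have key : ∀ a b : ℝ, 0 ≤ a → a < b → a * Real.exp a < b * Real.exp b := by
    intro a b ha hab
    exact mul_lt_mul'' hab (Real.exp_lt_exp.mpr hab) ha (Real.exp_pos a).le
  refine ⟨w, ⟨hw.1, hwx⟩, ?_⟩
  rintro y ⟨hy0, hy⟩
  have hwx' : w * Real.exp w = x := hwx
  rcases lt_trichotomy y w with h | h | h
  · have := key y w hy0 h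
    linarith
  · exact h
  · have := key w y hw.1 h
    linarith

open Classical in
/-- The Lambert function `W : [0, ∞) → [0, ∞)`, the unique function with
`W x * exp (W x) = x`; it is given the value `0` outside its domain. -/
def lambertW (x : ℝ) : ℝ :=
  if hx : 0 ≤ x then (existsUnique_lambertW x hx).choose else 0

theorem lambertW_spec (x : ℝ) (hx : 0 ≤ x) :
    0 ≤ lambertW x ∧ lambertW x * Real.exp (lambertW x) = x := by
  unfold lambertW
  rw [dif_pos hx]
  exact (existsUnique_lambertW x hx).choose_spec.1

namespace JAPTLM

variable {k : ℕ}

/-- The attractiveness `a_i(p_i) = exp (u_i - p_i)` of product `i`. The product with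
one-based index `i` is the element `i - 1` of `Fin k`. -/
def attr (u p : Fin k → ℝ) (i : Fin k) : ℝ := Real.exp (u i - p i)

/-- The expected revenue of the assortment of the `k` products at the price vector `p`,
with an outside option of attractiveness `a₀`. -/
def revenue (a₀ : ℝ) (u p : Fin k → ℝ) : ℝ :=
  (∑ i, p i * attr u p i) / (∑ i, attr u p i + a₀)

/-- Feasible price vectors: `a_i(p_i) - (1 + t) a_j(p_j) ≤ 0` for all `i < j`. -/
def Feasible (t : ℝ) (u p : Fin k → ℝ) : Prop :=
  ∀ i j : Fin k, i < j → attr u p i - (1 + t) * attr u p j ≤ 0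

/-- `p` is an optimal solution: it is feasible and maximises the revenue among the
feasible price vectors. -/
def IsOptimal (t a₀ : ℝ) (u p : Fin k → ℝ) : Prop :=
  Feasible t u p ∧ ∀ q : Fin k → ℝ, Feasible t u q → revenue a₀ u q ≤ revenue a₀ u p

/-- The top block `I₁ = {1, …, k₁}` (in one-based numbering). -/
def topBlock (k k₁ : ℕ) : Finset (Fin k) :=
  Finset.univ.filter fun i => (i : ℕ) < k₁

/-- The bottom block `I₂ = {k - k₂ + 1, …, k}` (in one-based numbering). -/
def bottomBlock (k k₂ : ℕ) : Finset (Fin k) :=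
  Finset.univ.filter fun i => k ≤ (i : ℕ) + k₂

/-- The middle block `{1, …, k} \ (I₁ ∪ I₂)`. -/
def middleBlock (k k₁ k₂ : ℕ) : Finset (Fin k) :=
  Finset.univ \ (topBlock k k₁ ∪ bottomBlock k k₂)

/-- The weighted mean
`((1 + t) ∑_{I₁} u_i + ∑_{I₂} u_i + k₂ ln (1 + t)) / (k₁ (1 + t) + k₂)`. -/
def blockMean (t : ℝ) (u : Fin k → ℝ) (k₁ k₂ : ℕ) : ℝ :=
  ((1 + t) * ∑ i ∈ topBlock k k₁, u i + ∑ i ∈ bottomBlock k k₂, u i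
    + k₂ * Real.log (1 + t)) / (k₁ * (1 + t) + k₂)

end JAPTLM

end

namespace JAPTLM

variable {k : ℕ}

/-! A dual certificate proves optimality, without any concavity argument. The bound `x + 1 ≤ exp x`
at `x = q i - p i` shows that, if the attractivenesses at `p` sum to `R * a₀` and `∑ (p i - 1 - R) *
attr u q i ≤ 0`, then `q` earns at most `R`, and strictly less when `q ≠ p`. If that sum vanishes at
`q = p`, then `p` earns exactly `R`. So optimality and uniqueness come together.

With `l = log (1 + t)`, suppose first that the utilities spread over at most `l`. Then `p i = 1 + R`
is feasible and the certificate sum is identically zero. Otherwise `p i - 1 - R` is the signed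
distance from `u i` to an interval `[C - l, C]`, where `C` makes `1 + t` times the total excess
above the interval equal to the total deficit below it. Pairing excesses with deficits through the
constraints gives the sign of the certificate. The block formulas are this balance equation solved
for `C`, and the equation for `R` is the one defining `W`. -/

theorem add_one_mul_exp_sub_le (u p q : ℝ) :
    (q - p + 1) * Real.exp (u - q) ≤ Real.exp (u - p) := by
  have h := mul_le_mul_of_nonneg_right (Real.add_one_le_exp (q - p)) (Real.exp_pos (u - q)).le
  rwa [← Real.exp_add, show q - p + (u - q) = u - p by ring] at h

theorem add_one_mul_exp_sub_lt (u : ℝ) {p q : ℝ} (hpq : q ≠ p) :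
    (q - p + 1) * Real.exp (u - q) < Real.exp (u - p) := by
  have h := mul_lt_mul_of_pos_right (Real.add_one_lt_exp (sub_ne_zero.mpr hpq))
    (Real.exp_pos (u - q))
  rwa [← Real.exp_add, show q - p + (u - q) = u - p by ring] at h

theorem sum_attr_add_pos {a₀ : ℝ} (ha₀ : 0 < a₀) (u p : Fin k → ℝ) :
    0 < ∑ i, attr u p i + a₀ :=
  add_pos_of_nonneg_of_pos (Finset.sum_nonneg fun _ _ => (Real.exp_pos _).le) ha₀

/-- The three sums are the part bounded by the exponential inequality, the certificate, and `R`
times the attractiveness in the denominator of the revenue. -/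
theorem sum_sub_mul_attr (R : ℝ) (u p q : Fin k → ℝ) :
    ∑ i, q i * attr u q i = ∑ i, (q i - p i + 1) * attr u q i
      + ∑ i, (p i - 1 - R) * attr u q i + R * ∑ i, attr u q i := by
  rw [Finset.mul_sum, ← Finset.sum_add_distrib, ← Finset.sum_add_distrib]
  exact Finset.sum_congr rfl fun i _ => by ring

theorem revenue_le_of_certificate {a₀ R : ℝ} (ha₀ : 0 < a₀) {u p q : Fin k → ℝ}
    (hR : ∑ i, attr u p i = R * a₀) (hq : ∑ i, (p i - 1 - R) * attr u q i ≤ 0) :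
    revenue a₀ u q ≤ R := by
  rw [revenue, div_le_iff₀ (sum_attr_add_pos ha₀ u q), sum_sub_mul_attr R u p q]
  have h : ∑ i, (q i - p i + 1) * attr u q i ≤ ∑ i, attr u p i :=
    Finset.sum_le_sum fun i _ => add_one_mul_exp_sub_le (u i) (p i) (q i)
  linarith

theorem revenue_lt_of_certificate {a₀ R : ℝ} (ha₀ : 0 < a₀) {u p q : Fin k → ℝ}
    (hR : ∑ i, attr u p i = R * a₀) (hq : ∑ i, (p i - 1 - R) * attr u q i ≤ 0) (hne : q ≠ p) :
    revenue a₀ u q < R := by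
  rw [revenue, div_lt_iff₀ (sum_attr_add_pos ha₀ u q), sum_sub_mul_attr R u p q]
  have h : ∑ i, (q i - p i + 1) * attr u q i < ∑ i, attr u p i := by
    obtain ⟨j, hj⟩ := Function.ne_iff.mp hne
    exact Finset.sum_lt_sum (fun i _ => add_one_mul_exp_sub_le (u i) (p i) (q i))
      ⟨j, Finset.mem_univ j, add_one_mul_exp_sub_lt (u j) hj⟩
  linarith

theorem revenue_eq_of_certificate {a₀ R : ℝ} (ha₀ : 0 < a₀) {u p : Fin k → ℝ}
    (hR : ∑ i, attr u p i = R * a₀) (hp : ∑ i, (p i - 1 - R) * attr u p i = 0) :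
    revenue a₀ u p = R := by
  rw [revenue, div_eq_iff (sum_attr_add_pos ha₀ u p).ne', sum_sub_mul_attr R u p p, hp]
  simp only [sub_self, zero_add, one_mul]
  linarith

theorem isOptimal_iff_of_certificate {t a₀ R : ℝ} (ha₀ : 0 < a₀) {u p : Fin k → ℝ}
    (hR : ∑ i, attr u p i = R * a₀) (hp : ∑ i, (p i - 1 - R) * attr u p i = 0)
    (hfeas : Feasible t u p)
    (hcert : ∀ q, Feasible t u q → ∑ i, (p i - 1 - R) * attr u q i ≤ 0) (q : Fin k → ℝ) :
    IsOptimal t a₀ u q ↔ q = p := by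
  have hrev := revenue_eq_of_certificate ha₀ hR hp
  constructor
  · rintro ⟨hq, hmax⟩
    by_contra hne
    exact absurd (hmax p hfeas)
      (not_le.mpr (hrev ▸ revenue_lt_of_certificate ha₀ hR (hcert q hq) hne))
  · rintro rfl
    exact ⟨hfeas, fun q hq => hrev ▸ revenue_le_of_certificate ha₀ hR (hcert q hq)⟩

/-- The Lambert function makes the total attractiveness of markup prices equal to `R * a₀`. -/
theorem sum_attr_eq_lambertW_mul {a₀ : ℝ} (ha₀ : 0 < a₀) (u c : Fin k → ℝ) {R : ℝ}
    (hR : R = lambertW ((∑ i, Real.exp (u i - 1 - c i)) / a₀)) :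
    ∑ i, attr u (fun i => 1 + R + c i) i = R * a₀ := by
  have h := (lambertW_spec ((∑ i, Real.exp (u i - 1 - c i)) / a₀)
    (div_nonneg (Finset.sum_nonneg fun _ _ => (Real.exp_pos _).le) ha₀.le)).2
  rw [← hR, eq_div_iff ha₀.ne'] at h
  have hsum : ∑ i, attr u (fun i => 1 + R + c i) i
      = Real.exp (-R) * ∑ i, Real.exp (u i - 1 - c i) := by
    rw [Finset.mul_sum]
    refine Finset.sum_congr rfl fun i _ => ?_
    rw [attr, ← Real.exp_add]
    congr 1
    ring
  have he : Real.exp (-R) * Real.exp R = 1 := by rw [← Real.exp_add]; simp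
  rw [hsum, ← h]
  linear_combination (R * a₀) * he

/-! ### Monotone index sets as blocks -/

theorem filter_eq_topBlock_of_isLowerSet {P : Fin k → Prop} [DecidablePred P]
    (hP : ∀ i j, i ≤ j → P j → P i) :
    Finset.univ.filter P = topBlock k (Finset.univ.filter P).card := by
  have hsub : ∀ i, P i → (i : ℕ) < (Finset.univ.filter P).card := by
    intro i hi
    have h : Finset.Iic i ⊆ Finset.univ.filter P := fun j hj => by
      simpa using hP j i (Finset.mem_Iic.mp hj) hi
    have := Finset.card_le_card h
    rw [Fin.card_Iic] at this
    omega
  ext i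
  simp only [topBlock, Finset.mem_filter, Finset.mem_univ, true_and]
  refine ⟨hsub i, fun hi => ?_⟩
  by_contra hn
  have h : Finset.univ.filter P ⊆ Finset.Iio i := fun j hj => by
    rw [Finset.mem_Iio]
    by_contra hij
    exact hn (hP i j (not_lt.mp hij) (by simpa using hj))
  have := Finset.card_le_card h
  rw [Fin.card_Iio] at this
  omega

theorem filter_eq_bottomBlock_of_isUpperSet {P : Fin k → Prop} [DecidablePred P]
    (hP : ∀ i j, i ≤ j → P i → P j) :
    Finset.univ.filter P = bottomBlock k (Finset.univ.filter P).card := by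
  have h := filter_eq_topBlock_of_isLowerSet (P := fun i => ¬ P i)
    fun i j hij hj hi => hj (hP i j hij hi)
  have hcard := Finset.card_filter_add_card_filter_not (s := (Finset.univ : Finset (Fin k))) P
  rw [Finset.card_univ, Fintype.card_fin] at hcard
  ext i
  have hi := Finset.ext_iff.mp h i
  simp only [topBlock, bottomBlock, Finset.mem_filter, Finset.mem_univ, true_and] at hi ⊢
  rw [← not_iff_not, hi]
  omega

/-! ### The level `C` and its markup shifts -/

/-- A balancing level `C` for the excesses above `C` and the deficits below `C - l`. -/
theorem exists_balanced_level {s l : ℝ} (hs : 0 < s) (u : Fin k → ℝ) {a b : Fin k}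
    (ha : ∀ i, u i ≤ u a) (hb : ∀ i, u b ≤ u i) (hab : u b + l < u a) :
    ∃ C, u b + l < C ∧ C < u a ∧
      s * ∑ i, max (u i - C) 0 = ∑ i, max (C - l - u i) 0 := by
  -- At `C = u b + l` no deficit remains, and at `C = u a` no excess, so `f` changes sign in
  -- between.
  let f : ℝ → ℝ := fun C => s * ∑ i, max (u i - C) 0 - ∑ i, max (C - l - u i) 0
  have hf : Continuous f := by fun_prop
  have hpos : ∀ (g : Fin k → ℝ) (j : Fin k), 0 < g j → 0 < ∑ i, max (g i) 0 := fun g j hj =>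
    Finset.sum_pos' (fun i _ => le_max_right _ _) ⟨j, Finset.mem_univ j, lt_max_of_lt_left hj⟩
  have hleft : 0 < f (u b + l) := by
    have h0 : ∑ i, max (u b + l - l - u i) 0 = 0 :=
      Finset.sum_eq_zero fun i _ => max_eq_right (by linarith [hb i])
    simp only [f, h0, sub_zero]
    exact mul_pos hs (hpos (fun i => u i - (u b + l)) a (by linarith))
  have hright : f (u a) < 0 := by
    have h0 : ∑ i, max (u i - u a) 0 = 0 :=
      Finset.sum_eq_zero fun i _ => max_eq_right (by linarith [ha i])
    simp only [f, h0, mul_zero, zero_sub, neg_neg_iff_pos]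
    exact hpos (fun i => u a - l - u i) b (by linarith)
  obtain ⟨C, hC, h0⟩ := intermediate_value_Ioo' hab.le hf.continuousOn ⟨hright, hleft⟩
  exact ⟨C, hC.1, hC.2, sub_eq_zero.mp h0⟩

/-- The markup correction: the signed distance from `x` to the interval `[C - l, C]`. -/
def markupShift (C l x : ℝ) : ℝ := max (x - C) 0 - max (C - l - x) 0

theorem markupShift_of_ge {C l x : ℝ} (hl : 0 ≤ l) (h : C ≤ x) :
    markupShift C l x = x - C := by
  rw [markupShift, max_eq_left (by linarith), max_eq_right (by linarith), sub_zero]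

theorem markupShift_of_le {C l x : ℝ} (hl : 0 ≤ l) (h : x ≤ C - l) :
    markupShift C l x = x - C + l := by
  rw [markupShift, max_eq_right (by linarith), max_eq_left (by linarith)]
  ring

theorem markupShift_of_mem {C l x : ℝ} (h₁ : C - l ≤ x) (h₂ : x ≤ C) :
    markupShift C l x = 0 := by
  rw [markupShift, max_eq_right (by linarith), max_eq_right (by linarith), sub_zero]

/-- Subtracting the shift projects `x` onto an interval of length `l`; this is what makes the
shifted prices feasible. -/
theorem sub_markupShift_mem {C l x : ℝ} (hl : 0 ≤ l) :
    C - l ≤ x - markupShift C l x ∧ x - markupShift C l x ≤ C := by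
  rcases le_total C x with h | h
  · rw [markupShift_of_ge hl h]
    constructor <;> linarith
  rcases le_total x (C - l) with h' | h'
  · rw [markupShift_of_le hl h']
    constructor <;> linarith
  · rw [markupShift_of_mem h' h]
    constructor <;> linarith

theorem feasible_of_sub_le_log {t : ℝ} (ht : 0 < t) {u p : Fin k → ℝ}
    (h : ∀ i j, i < j → (u i - p i) - (u j - p j) ≤ Real.log (1 + t)) : Feasible t u p := by
  intro i j hij
  have ht' : 0 < 1 + t := by linarith
  have he : (1 + t) * attr u p j = Real.exp (Real.log (1 + t) + (u j - p j)) := by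
    rw [Real.exp_add, Real.exp_log ht', attr]
  rw [he, attr, sub_nonpos, Real.exp_le_exp]
  linarith [h i j hij]

theorem feasible_markupShift {t : ℝ} (ht : 0 < t) (C R : ℝ) (u : Fin k → ℝ) :
    Feasible t u fun i => 1 + R + markupShift C (Real.log (1 + t)) (u i) := by
  have hl : 0 ≤ Real.log (1 + t) := Real.log_nonneg (by linarith)
  refine feasible_of_sub_le_log ht fun i j _ => ?_
  linarith [(sub_markupShift_mem (C := C) (x := u i) hl).2,
    (sub_markupShift_mem (C := C) (x := u j) hl).1]

/-- If the total weight of `B` is `s` times that of `A`, and `z` on the support of `A` is at most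
`s` times `z` on the support of `B`, then the `A`-weighted sum of `z` is at most the
`B`-weighted one. -/
theorem sum_mul_le_sum_mul_of_balanced {ι : Type*} (S : Finset ι) {s : ℝ} {A B z : ι → ℝ}
    (hA : ∀ i ∈ S, 0 ≤ A i) (hB : ∀ i ∈ S, 0 ≤ B i) (hpos : 0 < ∑ i ∈ S, B i)
    (hbal : s * ∑ i ∈ S, A i = ∑ i ∈ S, B i)
    (hz : ∀ i ∈ S, ∀ j ∈ S, 0 < A i → 0 < B j → z i ≤ s * z j) :
    ∑ i ∈ S, A i * z i ≤ ∑ i ∈ S, B i * z i := by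
  refine le_of_mul_le_mul_right ?_ hpos
  -- After multiplication by the total weight of `B`, the claim holds term by term over pairs `(i,
  -- j)`.
  calc (∑ i ∈ S, A i * z i) * ∑ j ∈ S, B j
      = ∑ i ∈ S, ∑ j ∈ S, A i * z i * B j := Finset.sum_mul_sum _ _ _ _
    _ ≤ ∑ i ∈ S, ∑ j ∈ S, (s * A i) * (B j * z j) := by
        refine Finset.sum_le_sum fun i hi => Finset.sum_le_sum fun j hj => ?_
        rcases (hA i hi).eq_or_lt with h | h
        · simp [← h]
        rcases (hB j hj).eq_or_lt with h' | h'
        · simp [← h']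
        have := mul_le_mul_of_nonneg_left (hz i hi j hj h h') (mul_pos h h').le
        linarith
    _ = (∑ i ∈ S, B i * z i) * ∑ j ∈ S, B j := by
        rw [← Finset.sum_mul_sum, ← Finset.mul_sum, hbal, mul_comm]

/-- An index with an excess has larger utility than one with a deficit, hence comes earlier, so the
constraint between them is available. -/
theorem sum_markupShift_mul_attr_nonpos {t C l : ℝ} (hl : 0 ≤ l) {u q : Fin k → ℝ}
    (hu : Antitone u) (hpos : 0 < ∑ i, max (C - l - u i) 0)
    (hbal : (1 + t) * ∑ i, max (u i - C) 0 = ∑ i, max (C - l - u i) 0)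
    (hq : Feasible t u q) : ∑ i, markupShift C l (u i) * attr u q i ≤ 0 := by
  simp only [markupShift, sub_mul, Finset.sum_sub_distrib, sub_nonpos]
  refine sum_mul_le_sum_mul_of_balanced _ (fun i _ => le_max_right _ _)
    (fun i _ => le_max_right _ _) hpos hbal fun i _ j _ hi hj => sub_nonpos.mp (hq i j ?_)
  have hi' : C < u i := by simpa using hi
  have hj' : 0 < C - l - u j := by simpa only [lt_max_iff, lt_irrefl, or_false] using hj
  by_contra hij
  linarith [hu (not_lt.mp hij)]

/-- Complementary slackness: at these prices every product with an excess has attractiveness `exp (C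
- 1 - R)` and every one with a deficit has exactly `1 / (1 + t)` of that, so the balance equation
cancels the sum. -/
theorem sum_markupShift_mul_attr_eq_zero {t C : ℝ} (ht : 0 < t) (R : ℝ) (u : Fin k → ℝ)
    (hbal : (1 + t) * ∑ i, max (u i - C) 0 = ∑ i, max (C - Real.log (1 + t) - u i) 0) :
    ∑ i, markupShift C (Real.log (1 + t)) (u i)
      * attr u (fun i => 1 + R + markupShift C (Real.log (1 + t)) (u i)) i = 0 := by
  have hl : 0 ≤ Real.log (1 + t) := Real.log_nonneg (by linarith)
  have ht' : 0 < 1 + t := by linarith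
  have hterm : ∀ i, markupShift C (Real.log (1 + t)) (u i)
      * attr u (fun i => 1 + R + markupShift C (Real.log (1 + t)) (u i)) i
      = Real.exp (C - 1 - R) / (1 + t)
        * ((1 + t) * max (u i - C) 0 - max (C - Real.log (1 + t) - u i) 0) := by
    intro i
    rw [attr]
    rcases le_total C (u i) with h | h
    · rw [markupShift_of_ge hl h, max_eq_left (by linarith), max_eq_right (by linarith),
        show u i - (1 + R + (u i - C)) = C - 1 - R by ring]
      field_simp
      ring
    rcases le_total (u i) (C - Real.log (1 + t)) with h' | h'
    · rw [markupShift_of_le hl h', max_eq_right (by linarith), max_eq_left (by linarith),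
        show u i - (1 + R + (u i - C + Real.log (1 + t))) = C - 1 - R - Real.log (1 + t) by ring,
        Real.exp_sub _ (Real.log (1 + t)), Real.exp_log ht']
      ring
    · rw [markupShift_of_mem h' h, max_eq_right (by linarith), max_eq_right (by linarith)]
      simp
  rw [Finset.sum_congr rfl fun i _ => hterm i, ← Finset.mul_sum, Finset.sum_sub_distrib,
    ← Finset.mul_sum, hbal, sub_self, mul_zero]

/-- The balance equation identifies the level `C` with the weighted mean of the two blocks. -/
theorem eq_blockMean_of_balanced {t C : ℝ} (ht : 0 < t) (u : Fin k → ℝ) {k₁ k₂ : ℕ}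
    (hk₁ : 0 < k₁)
    (htop : Finset.univ.filter (fun i => C < u i) = topBlock k k₁)
    (hbot : Finset.univ.filter (fun i => u i < C - Real.log (1 + t)) = bottomBlock k k₂)
    (hcard₁ : (topBlock k k₁).card = k₁) (hcard₂ : (bottomBlock k k₂).card = k₂)
    (hbal : (1 + t) * ∑ i, max (u i - C) 0 = ∑ i, max (C - Real.log (1 + t) - u i) 0) :
    C = blockMean t u k₁ k₂ := by
  have hmax : ∀ x : ℝ, max x 0 = if 0 < x then x else 0 := fun x => by
    split_ifs with h
    · exact max_eq_left h.le
    · exact max_eq_right (not_lt.mp h)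
  have h₁ : ∑ i, max (u i - C) 0 = ∑ i ∈ topBlock k k₁, u i - k₁ * C := by
    simp only [hmax, sub_pos]
    rw [← Finset.sum_filter, htop, Finset.sum_sub_distrib, Finset.sum_const, hcard₁, nsmul_eq_mul]
  have h₂ : ∑ i, max (C - Real.log (1 + t) - u i) 0
      = k₂ * (C - Real.log (1 + t)) - ∑ i ∈ bottomBlock k k₂, u i := by
    simp only [hmax, sub_pos]
    rw [← Finset.sum_filter, hbot, Finset.sum_sub_distrib, Finset.sum_const, hcard₂, nsmul_eq_mul]
  have hden : 0 < (k₁ : ℝ) * (1 + t) + k₂ := by positivity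
  rw [h₁, h₂] at hbal
  rw [blockMean, eq_div_iff hden.ne']
  linarith

theorem sum_blocks {k₁ k₂ : ℕ} (hdisj : Disjoint (topBlock k k₁) (bottomBlock k k₂))
    (f : Fin k → ℝ) :
    ∑ i, f i = ∑ i ∈ topBlock k k₁, f i + ∑ i ∈ bottomBlock k k₂, f i
      + ∑ i ∈ middleBlock k k₁ k₂, f i := by
  rw [← Finset.sum_union hdisj, middleBlock, add_comm]
  exact (Finset.sum_sdiff (Finset.subset_univ _)).symm

end JAPTLM

theorem mainTheorem6 {n k : ℕ} (hk : 0 < k) (hkn : k ≤ n) (t a₀ : ℝ) (ht : 0 < t)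
    (ha₀ : 0 < a₀) (U : Fin n → ℝ) (hU : Antitone U)
    (u : Fin k → ℝ) (hu : ∀ i, u i = U (Fin.castLE hkn i)) :
    ∃ p : Fin k → ℝ, ∃ R : ℝ,
      (∀ q : Fin k → ℝ, JAPTLM.IsOptimal t a₀ u q ↔ q = p) ∧
      R = JAPTLM.revenue a₀ u p ∧
      (Real.exp (u ⟨0, hk⟩ - u ⟨k - 1, Nat.sub_lt hk Nat.one_pos⟩) ≤ 1 + t →
        (∀ q : Fin k → ℝ, JAPTLM.revenue a₀ u q ≤ JAPTLM.revenue a₀ u p) ∧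
        R = lambertW ((∑ i, Real.exp (u i - 1)) / a₀) ∧
        ∀ i, p i = 1 + R) ∧
      (1 + t < Real.exp (u ⟨0, hk⟩ - u ⟨k - 1, Nat.sub_lt hk Nat.one_pos⟩) →
        JAPTLM.attr u p ⟨0, hk⟩ / JAPTLM.attr u p ⟨k - 1, Nat.sub_lt hk Nat.one_pos⟩ = 1 + t ∧
        ∃ k₁ k₂ : ℕ, 1 ≤ k₁ ∧ 1 ≤ k₂ ∧ k₁ + k₂ ≤ k ∧
          R = lambertW
            ((((k₁ : ℝ) + k₂ / (1 + t)) * Real.exp (JAPTLM.blockMean t u k₁ k₂ - 1)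
              + ∑ i ∈ JAPTLM.middleBlock k k₁ k₂, Real.exp (u i - 1)) / a₀) ∧
          (∀ i ∈ JAPTLM.topBlock k k₁,
            p i = 1 + R + u i - JAPTLM.blockMean t u k₁ k₂) ∧
          (∀ i ∈ JAPTLM.bottomBlock k k₂,
            p i = 1 + R + u i - JAPTLM.blockMean t u k₁ k₂ + Real.log (1 + t)) ∧
          (∀ i ∈ JAPTLM.middleBlock k k₁ k₂, p i = 1 + R)) := by
  have hua : Antitone u := fun i j hij => by
    rw [hu, hu]
    exact hU hij
  set a : Fin k := ⟨0, hk⟩ with ha_def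
  set b : Fin k := ⟨k - 1, Nat.sub_lt hk Nat.one_pos⟩ with hb_def
  have ha : ∀ i, u i ≤ u a := fun i => hua (Fin.mk_le_of_le_val (Nat.zero_le _))
  have hb : ∀ i, u b ≤ u i := fun i => hua (Fin.le_def.mpr (Nat.le_sub_one_of_lt i.isLt))
  have ht' : 0 < 1 + t := by linarith
  set l := Real.log (1 + t) with hl_def
  have hl : 0 < l := Real.log_pos (by linarith)
  by_cases hcase : Real.exp (u a - u b) ≤ 1 + t
  · have hul : u a - u b ≤ l := (Real.le_log_iff_exp_le ht').mpr hcase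
    set R := lambertW ((∑ i, Real.exp (u i - 1)) / a₀) with hR_def
    have hR : ∑ i, JAPTLM.attr u (fun _ => 1 + R) i = R * a₀ := by
      have := JAPTLM.sum_attr_eq_lambertW_mul ha₀ u (fun _ => 0) (R := R) (by simp [hR_def])
      simpa using this
    have hzero : ∀ q : Fin k → ℝ, ∑ i : Fin k, ((1 + R) - 1 - R) * JAPTLM.attr u q i = 0 :=
      fun q => Finset.sum_eq_zero fun i _ => by ring
    have hrev := JAPTLM.revenue_eq_of_certificate ha₀ hR (hzero _)
    refine ⟨fun _ => 1 + R, R, ?_, hrev.symm, ?_, fun h => absurd hcase (not_le.mpr h)⟩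
    · refine JAPTLM.isOptimal_iff_of_certificate ha₀ hR (hzero _) ?_ fun q _ => (hzero q).le
      exact JAPTLM.feasible_of_sub_le_log ht fun i j _ => by linarith [ha i, hb j]
    · refine fun _ => ⟨fun q => ?_, rfl, fun _ => rfl⟩
      rw [hrev]
      exact JAPTLM.revenue_le_of_certificate ha₀ hR (hzero q).le
  · have hul : u b + l < u a := by
      have := (Real.log_lt_iff_lt_exp ht').mpr (not_le.mp hcase)
      linarith
    obtain ⟨C, hbC, hCa, hbal⟩ := JAPTLM.exists_balanced_level ht' u ha hb hul
    have hpos : 0 < ∑ i, max (C - l - u i) 0 :=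
      Finset.sum_pos' (fun i _ => le_max_right _ _)
        ⟨b, Finset.mem_univ b, lt_max_of_lt_left (by linarith)⟩
    set R := lambertW ((∑ i, Real.exp (u i - 1 - JAPTLM.markupShift C l (u i))) / a₀) with hR_def
    set p : Fin k → ℝ := fun i => 1 + R + JAPTLM.markupShift C l (u i) with hp_def
    have hR : ∑ i, JAPTLM.attr u p i = R * a₀ := JAPTLM.sum_attr_eq_lambertW_mul ha₀ u _ hR_def
    have hshift : ∀ i, p i - 1 - R = JAPTLM.markupShift C l (u i) := fun i => by
      rw [hp_def]
      ring
    have hp0 : ∑ i, (p i - 1 - R) * JAPTLM.attr u p i = 0 := by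
      simp only [hshift]
      exact JAPTLM.sum_markupShift_mul_attr_eq_zero ht R u hbal
    refine ⟨p, R, ?_, (JAPTLM.revenue_eq_of_certificate ha₀ hR hp0).symm,
      fun h => absurd h hcase, fun _ => ⟨?_, ?_⟩⟩
    · refine JAPTLM.isOptimal_iff_of_certificate ha₀ hR hp0
        (JAPTLM.feasible_markupShift ht C R u) fun q hq => ?_
      simp only [hshift]
      exact JAPTLM.sum_markupShift_mul_attr_nonpos hl.le hua hpos hbal hq
    · rw [JAPTLM.attr, JAPTLM.attr, ← Real.exp_sub, ← Real.exp_log ht', hp_def]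
      simp only [JAPTLM.markupShift_of_ge hl.le hCa.le,
        JAPTLM.markupShift_of_le hl.le (show u b ≤ C - l by linarith)]
      rw [Real.exp_eq_exp, ← hl_def]
      ring
    -- The strict inequalities leave ties `u i = C` and `u i = C - l` to the middle block, where the
    -- shift is zero anyway.
    · have htop := JAPTLM.filter_eq_topBlock_of_isLowerSet (P := fun i => C < u i)
        fun i j hij hj => lt_of_lt_of_le hj (hua hij)
      have hbot := JAPTLM.filter_eq_bottomBlock_of_isUpperSet (P := fun i => u i < C - l)
        fun i j hij hi => lt_of_le_of_lt (hua hij) hi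
      have hdisj : Disjoint (Finset.univ.filter fun i => C < u i)
          (Finset.univ.filter fun i => u i < C - l) :=
        Finset.disjoint_filter.mpr fun i _ h₁ h₂ => by linarith
      have hk₁ : 0 < (Finset.univ.filter fun i => C < u i).card :=
        Finset.card_pos.mpr ⟨a, by simpa using hCa⟩
      have hk₂ : 0 < (Finset.univ.filter fun i => u i < C - l).card :=
        Finset.card_pos.mpr ⟨b, Finset.mem_filter.mpr ⟨Finset.mem_univ b, by linarith⟩⟩
      have hle : (Finset.univ.filter fun i => C < u i).card
          + (Finset.univ.filter fun i => u i < C - l).card ≤ k := by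
        rw [← Finset.card_union_of_disjoint hdisj]
        exact (Finset.card_le_univ _).trans_eq (Fintype.card_fin k)
      have hcard₁ := congrArg Finset.card htop.symm
      have hcard₂ := congrArg Finset.card hbot.symm
      have hmem₁ : ∀ i, i ∈ (Finset.univ.filter fun i => C < u i) ↔ C < u i := by simp
      have hmem₂ : ∀ i, i ∈ (Finset.univ.filter fun i => u i < C - l) ↔ u i < C - l := by simp
      rw [htop, hbot] at hdisj
      rw [htop] at hmem₁
      rw [hbot] at hmem₂
      generalize (Finset.univ.filter fun i => C < u i).card = k₁ at *
      generalize (Finset.univ.filter fun i => u i < C - l).card = k₂ at *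
      have hC := JAPTLM.eq_blockMean_of_balanced ht u hk₁ htop hbot hcard₁ hcard₂ hbal
      have hs₁ : ∀ i ∈ JAPTLM.topBlock k k₁, JAPTLM.markupShift C l (u i) = u i - C :=
        fun i hi => JAPTLM.markupShift_of_ge hl.le ((hmem₁ i).mp hi).le
      have hs₂ : ∀ i ∈ JAPTLM.bottomBlock k k₂, JAPTLM.markupShift C l (u i) = u i - C + l :=
        fun i hi => JAPTLM.markupShift_of_le hl.le ((hmem₂ i).mp hi).le
      have hs₃ : ∀ i ∈ JAPTLM.middleBlock k k₁ k₂, JAPTLM.markupShift C l (u i) = 0 := by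
        intro i hi
        simp only [JAPTLM.middleBlock, Finset.mem_sdiff, Finset.mem_univ, true_and,
          Finset.mem_union, hmem₁, hmem₂, not_or, not_lt] at hi
        exact JAPTLM.markupShift_of_mem hi.2 hi.1
      refine ⟨k₁, k₂, hk₁, hk₂, hle, ?_, fun i hi => ?_, fun i hi => ?_, fun i hi => ?_⟩
      · rw [← hC, hR_def]
        congr 2
        rw [JAPTLM.sum_blocks hdisj]
        congr 1
        · have e₁ : ∀ i ∈ JAPTLM.topBlock k k₁,
              Real.exp (u i - 1 - JAPTLM.markupShift C l (u i)) = Real.exp (C - 1) :=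
            fun i hi => by rw [hs₁ i hi]; congr 1; ring
          have e₂ : ∀ i ∈ JAPTLM.bottomBlock k k₂,
              Real.exp (u i - 1 - JAPTLM.markupShift C l (u i)) = Real.exp (C - 1) / (1 + t) :=
            fun i hi => by
              rw [hs₂ i hi, ← Real.exp_log ht', ← Real.exp_sub, ← hl_def]
              congr 1
              ring
          rw [Finset.sum_congr rfl e₁, Finset.sum_congr rfl e₂, Finset.sum_const,
            Finset.sum_const, hcard₁, hcard₂, nsmul_eq_mul, nsmul_eq_mul]
          ring
        · exact Finset.sum_congr rfl fun i hi => by rw [hs₃ i hi, sub_zero]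
      · rw [← hC, hp_def]
        simp only [hs₁ i hi]
        ring
      · rw [← hC, hp_def]
        simp only [hs₂ i hi]
        ring
      · rw [hp_def]
        simp only [hs₃ i hi, add_zero]
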